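/- Let $\mathbb X,\mathbb Y$ be finite alphabets, $p_0$ a probability mass function (PMF) on $\mathbb X$, $p_{Y|X}$ a conditional PMF on $\mathbb Y$ given $\mathbb X$, and $p_{X,Y}(x,y)=p_0(x)p_{Y|X}(y|x)$. For functions $p,q$ on $\mathbb X\times\mathbb Y$ let $\|p-q\|_{TV}=\frac12\sum_{x,y}|p(x,y)-q(x,y)|$, and for $\Delta\in\mathbb R$ let $N_\Delta(p)$ be the set of PMFs $q$ with $\|p-q\|_{TV}\le\Delta$. The joint type of $(x^n,y^n)\in\mathbb X^n\times\mathbb Y^n$ is $P_{x^n,y^n}(x,y)=\frac1n\sum_{k=1}^n\mathbf 1\{(x_k,y_k)=(x,y)\}$. For $R_1,R_2\in\mathbb R$ and $n\ge1$, an $(e^{nR_1},e^{nR_2},n)$ coordination code consists of encoders $i_j:\mathbb X^n\to\{1,\dots,\lfloor e^{nR_j}\rfloor\}$ ($j=1,2$) and decoders $y_j^n:\{1,\dots,\lfloor e^{nR_j}\rfloor\}\to\mathbb Y^n$ ($j=1,2$) and $y_{12}^n:\{1,\dots,\lfloor e^{nR_1}\rfloor\}\times\{1,\dots,\lfloor e^{nR_2}\rfloor\}\to\mathbb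 Y^n$. The PMF $p_{X,Y}$ is achievable for $\Delta_1\Delta_2\Delta_{12}$-empirical coordination at rates $(R_1,R_2)$ if there is an $N$ such that for all $n>N$ there is such a code with $$\mathbb E\,\bigl\|P_{X^n,\,y_j^n(i_j(X^n))}-p_{X,Y}\bigr\|_{TV}\le\Delta_j\ (j=1,2),\qquad \mathbb E\,\bigl\|P_{X^n,\,y_{12}^n(i_1(X^n),i_2(X^n))}-p_{X,Y}\bigr\|_{TV}\le\Delta_{12},$$ where $X^n$ is i.i.d. with law $p_0$. The multiple-rate-distortion-coordination region $R^I_{p_0}(p_{Y|X})$ is the closure in $\mathbb R^5$ of the set of all $(R_1,R_2,\Delta_1,\Delta_2,\Delta_{12})$ for which this holds. **Theorem 1.** Let $(R_1,R_2,\Delta_1,\Delta_2,\Delta_{12})\in\mathbb R^5$ and suppose that there is a conditional PMF $p_{\hat Y^{(1)},\hat Y^{(2)},\hat Y^{(12)}|X}$ on $\mathbb Y^3$ given $\mathbb X$ such that $p_0\,p_{\hat Y^{(i)}|X}\in N_{\Delta_i}(p_{X,Y})$ for $i=1,2,12$ and, with mutual informations (in nats) computed under $p_0\,p_{\hat Y^{(1)},\hat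 Y^{(2)},\hat Y^{(12)}|X}$, $$R_1\ge I(X;\hat Y^{(1)}),\qquad R_2\ge I(X;\hat Y^{(2)}),\qquad R_1+R_2\ge I(X;\hat Y^{(1)},\hat Y^{(2)},\hat Y^{(12)})+I(\hat Y^{(1)};\hat Y^{(2)}).$$ Then $(R_1,R_2,\Delta_1,\Delta_2,\Delta_{12})\in R^I_{p_0}(p_{Y|X})$. -/

import Mathlib

noncomputable section

namespace Coordination

/-- The joint law `p₀(x) W(y|x)` of an input PMF `p₀` and a conditional PMF `W`. -/
def joint {α β : Type*} (p₀ : PMF α) (W : α → PMF β) : PMF (α × β) :=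
  p₀.bind fun a => (W a).map fun b => (a, b)

/-- The value of a PMF as a real number. -/
def mass {α : Type*} (p : PMF α) (a : α) : ℝ := (p a).toReal

/-- Total variation `½ ∑ |p - q|` between two mass functions on a finite set. -/
def tv {α : Type*} [Fintype α] (p q : α → ℝ) : ℝ :=
  1 / 2 * ∑ a, |p a - q a|

/-- The `Δ`-neighborhood of a PMF in total variation. -/
def neighborhood {α : Type*} [Fintype α] (Δ : ℝ) (p : PMF α) : Set (PMF α) :=
  {q | tv (mass p) (mass q) ≤ Δ}

/-- Mutual information, in nats, between the two coordinates of a joint PMF on a finite set.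
Terms of zero mass contribute `0`. -/
def mutualInfo {α β : Type*} [Fintype α] [Fintype β] (p : PMF (α × β)) : ℝ :=
  ∑ a, ∑ b, mass p (a, b) *
    Real.log (mass p (a, b) / (mass (p.map Prod.fst) a * mass (p.map Prod.snd) b))

open Classical in
/-- Joint type (empirical mass function) of two sequences of length `n`. -/
def jointType {α β : Type*} {n : ℕ} (x : Fin n → α) (y : Fin n → β) (c : α × β) : ℝ :=
  1 / (n : ℝ) * ∑ k, if (x k, y k) = c then (1 : ℝ) else 0

/-- Number of messages at rate `R` (nats per symbol) and blocklength `n`. -/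
def numMessages (R : ℝ) (n : ℕ) : ℕ := ⌊Real.exp (n * R)⌋₊

/-- An `(e^{nR₁}, e^{nR₂}, n)` coordination code: two encoders and three decoders. -/
structure Code (𝕏 𝕐 : Type*) (R₁ R₂ : ℝ) (n : ℕ) where
  enc₁ : (Fin n → 𝕏) → Fin (numMessages R₁ n)
  enc₂ : (Fin n → 𝕏) → Fin (numMessages R₂ n)
  dec₁ : Fin (numMessages R₁ n) → Fin n → 𝕐
  dec₂ : Fin (numMessages R₂ n) → Fin n → 𝕐
  dec₁₂ : Fin (numMessages R₁ n) × Fin (numMessages R₂ n) → Fin n → 𝕐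

/-- Expected total variation between the target `p` and the joint type of `(xⁿ, g(xⁿ))`,
where `xⁿ` is i.i.d. with law `p₀` and `g` gives the reconstruction. -/
def expectedTV {𝕏 𝕐 : Type*} [Fintype 𝕏] [Fintype 𝕐] (p₀ : PMF 𝕏) (p : PMF (𝕏 × 𝕐)) {n : ℕ}
    (g : (Fin n → 𝕏) → Fin n → 𝕐) : ℝ :=
  ∑ x : Fin n → 𝕏, (∏ k, mass p₀ (x k)) * tv (jointType x (g x)) (mass p)

/-- The target `p₀(x) W(y|x)` is achievable for `Δ₁Δ₂Δ₁₂`-empirical coordination at rates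
`(R₁, R₂)`. -/
def Achievable {𝕏 𝕐 : Type*} [Fintype 𝕏] [Fintype 𝕐] (p₀ : PMF 𝕏) (W : 𝕏 → PMF 𝕐)
    (R₁ R₂ Δ₁ Δ₂ Δ₁₂ : ℝ) : Prop :=
  ∃ N : ℕ, ∀ n : ℕ, N < n → ∃ C : Code 𝕏 𝕐 R₁ R₂ n,
    expectedTV p₀ (joint p₀ W) (fun x => C.dec₁ (C.enc₁ x)) ≤ Δ₁ ∧
    expectedTV p₀ (joint p₀ W) (fun x => C.dec₂ (C.enc₂ x)) ≤ Δ₂ ∧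
    expectedTV p₀ (joint p₀ W) (fun x => C.dec₁₂ (C.enc₁ x, C.enc₂ x)) ≤ Δ₁₂

/-- The multiple-rate-distortion-coordination region: the closure in `ℝ⁵` of the set of
achievable tuples `(R₁, R₂, Δ₁, Δ₂, Δ₁₂)`. -/
def region {𝕏 𝕐 : Type*} [Fintype 𝕏] [Fintype 𝕐] (p₀ : PMF 𝕏) (W : 𝕏 → PMF 𝕐) :
    Set (ℝ × ℝ × ℝ × ℝ × ℝ) :=
  closure {t | Achievable p₀ W t.1 t.2.1 t.2.2.1 t.2.2.2.1 t.2.2.2.2}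

/-- The conditional law of `f(Ŷ)` given `X`, from the conditional law of `Ŷ` given `X`. -/
def condMap {α β γ : Type*} (Q : α → PMF β) (f : β → γ) : α → PMF γ :=
  fun a => (Q a).map f

/-- The region of the rate conditions for a test channel `Q`, the conditional law of
`(Ŷ⁽¹⁾, Ŷ⁽²⁾, Ŷ⁽¹²⁾)` given `X`. -/
def rateRegion {𝕏 𝕐 : Type*} [Fintype 𝕏] [Fintype 𝕐] (p₀ : PMF 𝕏)
    (Q : 𝕏 → PMF (𝕐 × 𝕐 × 𝕐)) : Set (ℝ × ℝ) :=
  {r | mutualInfo (joint p₀ (condMap Q fun y => y.1)) ≤ r.1 ∧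
    mutualInfo (joint p₀ (condMap Q fun y => y.2.1)) ≤ r.2 ∧
    mutualInfo (joint p₀ Q) + mutualInfo ((p₀.bind Q).map fun y => (y.1, y.2.1)) ≤ r.1 + r.2}

end Coordination

end

/-! Random coding with superposition. Words `U i` and `V j` are drawn independently from the output
marginals of the test channel, and a word `Z (i, j)` for each pair from the conditional law of the
third letter given the first two. Both encoders see the whole source word, so they can jointly pick
a pair (i, j) for which (x, `U i`, `V j`, `Z (i, j)`) is typical; typicality makes all three joint
types close to their targets.

The core is a one-shot covering bound (`codebookExp_miss_le`) obtained by the second-moment method.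
Each codeword triple is weighted by the likelihood ratio of the test channel to the codebook law. If
no triple is typical, all weights, truncated to the typical set, vanish, which is a large deviation
of their sum. The variance splits according to whether two index pairs share j, share i, or
coincide, and these cases produce the conditions on R₂, R₁ and R₁ + R₂. The exponent of the last
case is I(X; Ŷ⁽¹⁾, Ŷ⁽²⁾, Ŷ⁽¹²⁾) + I(Ŷ⁽¹⁾; Ŷ⁽²⁾), by `mass_eq_exp_totalDensity_mul`.

A Chebyshev law of large numbers (`sum_atypical_le`) handles atypical sequences. `achievable_add`
gives achievability with slack δ in every coordinate, and the closure removes δ. -/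

namespace Coordination

/-! ### Moments of functions of independent coordinates -/

section FiniteProduct

variable {ι β : Type*} [Fintype ι] [DecidableEq ι] [Fintype β]

theorem sum_pi_prod (g : ι → β → ℝ) : ∑ f : ι → β, ∏ i, g i (f i) = ∏ i, ∑ b, g i b := by
  rw [Finset.prod_univ_sum, Fintype.piFinset_univ]

theorem sum_pi_prod_eq_one {q : ι → β → ℝ} (hq : ∀ i, ∑ b, q i b = 1) :
    ∑ f : ι → β, ∏ i, q i (f i) = 1 := by
  rw [sum_pi_prod]
  exact Finset.prod_eq_one fun i _ => hq i

theorem sum_pi_prod_mul_apply {q : ι → β → ℝ} (hq : ∀ i, ∑ b, q i b = 1) (a : ι) (g : β → ℝ) :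
    ∑ f : ι → β, (∏ i, q i (f i)) * g (f a) = ∑ b, q a b * g b := by
  have h := sum_pi_prod fun i b => q i b * (if i = a then g b else 1)
  simp only [Finset.prod_mul_distrib, Finset.prod_ite_eq', Finset.mem_univ, if_true] at h
  rw [h, Finset.prod_eq_single a]
  · simp
  · intro b _ hb
    simp [hb, hq]
  · simp

theorem sum_pi_prod_mul_apply_mul_apply {q : ι → β → ℝ} (hq : ∀ i, ∑ b, q i b = 1) {a c : ι}
    (hac : a ≠ c) (g g' : β → ℝ) :
    ∑ f : ι → β, (∏ i, q i (f i)) * (g (f a) * g' (f c)) =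
      (∑ b, q a b * g b) * ∑ b, q c b * g' b := by
  have h := sum_pi_prod fun i b =>
    q i b * ((if i = a then g b else 1) * (if i = c then g' b else 1))
  simp only [Finset.prod_mul_distrib, Finset.prod_ite_eq', Finset.mem_univ, if_true] at h
  rw [h, ← Finset.mul_prod_erase Finset.univ _ (Finset.mem_univ a),
    ← Finset.mul_prod_erase _ _ (Finset.mem_erase.2 ⟨hac.symm, Finset.mem_univ c⟩),
    Finset.prod_eq_one]
  · simp [hac, hac.symm]
  · intro i hi
    simp only [Finset.mem_erase, Finset.mem_univ, and_true] at hi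
    simp [hi.1, hi.2, hq]

theorem sum_pi_prod_mul_sum {q : ι → β → ℝ} (hq : ∀ i, ∑ b, q i b = 1) (g : ι → β → ℝ) :
    ∑ f : ι → β, (∏ i, q i (f i)) * ∑ i, g i (f i) = ∑ i, ∑ b, q i b * g i b := by
  simp only [Finset.mul_sum]
  rw [Finset.sum_comm]
  exact Finset.sum_congr rfl fun i _ => sum_pi_prod_mul_apply hq i (g i)

/-- Second moment of a sum of functions of independent coordinates. -/
theorem sum_pi_prod_mul_sq_le {q : ι → β → ℝ} (hq : ∀ i, ∑ b, q i b = 1)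
    (g : ι → β → ℝ) : ∑ f : ι → β, (∏ i, q i (f i)) * (∑ i, g i (f i)) ^ 2 ≤
      (∑ i, ∑ b, q i b * g i b) ^ 2 + ∑ i, ∑ b, q i b * g i b ^ 2 := by
  have h1 : ∑ f : ι → β, (∏ i, q i (f i)) * (∑ i, g i (f i)) ^ 2 =
      ∑ i, ∑ j, ∑ f : ι → β, (∏ i, q i (f i)) * (g i (f i) * g j (f j)) := by
    simp only [sq, Finset.sum_mul_sum]
    simp only [Finset.mul_sum]
    rw [Finset.sum_comm]
    exact Finset.sum_congr rfl fun i _ => Finset.sum_comm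
  have h2 : (∑ i, ∑ b, q i b * g i b) ^ 2 + ∑ i, ∑ b, q i b * g i b ^ 2 =
      ∑ i, ∑ j, ((∑ b, q i b * g i b) * (∑ b, q j b * g j b) +
        if i = j then ∑ b, q i b * g i b ^ 2 else 0) := by
    simp [sq, Finset.sum_mul_sum, Finset.sum_add_distrib]
  rw [h1, h2]
  refine Finset.sum_le_sum fun i _ => Finset.sum_le_sum fun j _ => ?_
  by_cases hij : i = j
  · subst hij
    rw [sum_pi_prod_mul_apply hq i fun b => g i b * g i b]
    simp only [← sq, if_true]
    -- On the diagonal the right side carries an extra squared mean, so only an inequality holds.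
    nlinarith [sq_nonneg (∑ b, q i b * g i b)]
  · rw [sum_pi_prod_mul_apply_mul_apply hq hij]
    simp [hij]

end FiniteProduct

theorem sq_sum_mul_le {β : Type*} [Fintype β] {q : β → ℝ} (hq0 : ∀ b, 0 ≤ q b)
    (hq : ∑ b, q b = 1) (g : β → ℝ) : (∑ b, q b * g b) ^ 2 ≤ ∑ b, q b * g b ^ 2 := by
  have := Finset.sum_sq_le_sum_mul_sum_of_sq_le_mul Finset.univ (r := fun b => q b * g b)
    (f := q) (g := fun b => q b * g b ^ 2) (fun b _ => hq0 b)
    (fun b _ => mul_nonneg (hq0 b) (sq_nonneg _)) (fun b _ => le_of_eq (by ring))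
  rwa [hq, one_mul] at this

/-- The probabilistic method: applied to `U`, `V`, `Z` in turn, it fixes a deterministic codebook.
-/
theorem exists_le_of_sum_mul_le {β : Type*} [Fintype β] {q : β → ℝ} (hq0 : ∀ b, 0 ≤ q b)
    (hq : ∑ b, q b = 1) {F : β → ℝ} {c : ℝ} (h : ∑ b, q b * F b ≤ c) : ∃ b, F b ≤ c := by
  by_contra! hF
  obtain ⟨b, -, hb⟩ : ∃ b ∈ Finset.univ, 0 < q b := by
    by_contra! h0
    linarith [Finset.sum_nonpos h0]
  have : ∑ b, q b * c < ∑ b, q b * F b :=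
    Finset.sum_lt_sum (fun b _ => mul_le_mul_of_nonneg_left (hF b).le (hq0 b))
      ⟨b, Finset.mem_univ b, mul_lt_mul_of_pos_left (hF b) hb⟩
  rw [← Finset.sum_mul, hq] at this
  linarith

/-! ### Random superposition codebooks -/

section Codebook

variable {I J B C D : Type*} [Fintype I] [Fintype J] [Fintype B] [Fintype C] [Fintype D]
  [DecidableEq I] [DecidableEq J]

/-- Expectation over a random codebook with independent words `U i ∼ q₁`, `V j ∼ q₂`, and words
`Z (i, j) ∼ κ (U i) (V j)` that are conditionally independent given `U` and `V`. -/
noncomputable def codebookExp (q₁ : B → ℝ) (q₂ : C → ℝ) (κ : B → C → D → ℝ)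
    (F : (I → B) → (J → C) → (I × J → D) → ℝ) : ℝ :=
  ∑ U : I → B, (∏ i, q₁ (U i)) * ∑ V : J → C, (∏ j, q₂ (V j)) *
    ∑ Z : I × J → D, (∏ k, κ (U k.1) (V k.2) (Z k)) * F U V Z

variable {q₁ : B → ℝ} {q₂ : C → ℝ} {κ : B → C → D → ℝ}

theorem codebookExp_mono (h₁ : ∀ u, 0 ≤ q₁ u) (h₂ : ∀ v, 0 ≤ q₂ v) (hκ : ∀ u v z, 0 ≤ κ u v z)
    {F G : (I → B) → (J → C) → (I × J → D) → ℝ} (h : ∀ U V Z, F U V Z ≤ G U V Z) :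
    codebookExp q₁ q₂ κ F ≤ codebookExp q₁ q₂ κ G := by
  unfold codebookExp
  gcongr with U _ V _ Z _
  · exact Finset.prod_nonneg fun i _ => h₁ _
  · exact Finset.prod_nonneg fun i _ => h₂ _
  · exact Finset.prod_nonneg fun i _ => hκ _ _ _
  · exact h U V Z

theorem codebookExp_mul_right (F : (I → B) → (J → C) → (I × J → D) → ℝ) (c : ℝ) :
    codebookExp q₁ q₂ κ (fun U V Z => F U V Z * c) = codebookExp q₁ q₂ κ F * c := by
  simp only [codebookExp, ← mul_assoc, ← Finset.sum_mul]

theorem codebookExp_sum {A : Type*} [Fintype A] (p : A → ℝ)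
    (F : A → (I → B) → (J → C) → (I × J → D) → ℝ) :
    codebookExp q₁ q₂ κ (fun U V Z => ∑ x, p x * F x U V Z) =
      ∑ x, p x * codebookExp q₁ q₂ κ (F x) := by
  simp only [codebookExp, Finset.mul_sum]
  rw [Finset.sum_comm (s := (Finset.univ : Finset A))]
  refine Finset.sum_congr rfl fun U _ => ?_
  rw [Finset.sum_comm (s := (Finset.univ : Finset A))]
  refine Finset.sum_congr rfl fun V _ => ?_
  rw [Finset.sum_comm (s := (Finset.univ : Finset A))]
  refine Finset.sum_congr rfl fun Z _ => Finset.sum_congr rfl fun x _ => ?_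
  ring

theorem exists_le_of_codebookExp_le (h₁ : ∀ u, 0 ≤ q₁ u) (s₁ : ∑ u, q₁ u = 1)
    (h₂ : ∀ v, 0 ≤ q₂ v) (s₂ : ∑ v, q₂ v = 1)
    (hκ : ∀ u v z, 0 ≤ κ u v z) (sκ : ∀ u v, ∑ z, κ u v z = 1)
    {F : (I → B) → (J → C) → (I × J → D) → ℝ} {c : ℝ} (h : codebookExp q₁ q₂ κ F ≤ c) :
    ∃ U V Z, F U V Z ≤ c := by
  unfold codebookExp at h
  have p₁ (U : I → B) : 0 ≤ ∏ i, q₁ (U i) := Finset.prod_nonneg fun _ _ => h₁ _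
  have p₂ (V : J → C) : 0 ≤ ∏ j, q₂ (V j) := Finset.prod_nonneg fun _ _ => h₂ _
  obtain ⟨U, hU⟩ := exists_le_of_sum_mul_le p₁ (sum_pi_prod_eq_one fun _ => s₁) h
  obtain ⟨V, hV⟩ := exists_le_of_sum_mul_le p₂ (sum_pi_prod_eq_one fun _ => s₂) hU
  have p₃ (Z : I × J → D) : 0 ≤ ∏ k, κ (U k.1) (V k.2) (Z k) :=
    Finset.prod_nonneg fun _ _ => hκ _ _ _
  obtain ⟨Z, hZ⟩ := exists_le_of_sum_mul_le p₃
    (sum_pi_prod_eq_one (q := fun k : I × J => κ (U k.1) (V k.2)) fun _ => sκ _ _) hV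
  exact ⟨U, V, Z, hZ⟩

/-- Second moment of the sum of `w (U i) (V j) (Z (i, j))` over a random codebook. -/
theorem codebookExp_sq_sum_le (h₁ : ∀ u, 0 ≤ q₁ u) (s₁ : ∑ u, q₁ u = 1)
    (h₂ : ∀ v, 0 ≤ q₂ v) (s₂ : ∑ v, q₂ v = 1)
    (hκ : ∀ u v z, 0 ≤ κ u v z) (sκ : ∀ u v, ∑ z, κ u v z = 1) (w : B → C → D → ℝ) :
    codebookExp q₁ q₂ κ
        (fun (U : I → B) (V : J → C) Z => (∑ k, w (U k.1) (V k.2) (Z k)) ^ 2) ≤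
      (Fintype.card I * Fintype.card J * ∑ u, q₁ u * ∑ v, q₂ v * ∑ z, κ u v z * w u v z) ^ 2 +
      Fintype.card I ^ 2 * Fintype.card J *
        ∑ v, q₂ v * (∑ u, q₁ u * ∑ z, κ u v z * w u v z) ^ 2 +
      Fintype.card I * Fintype.card J ^ 2 *
        ∑ u, q₁ u * (∑ v, q₂ v * ∑ z, κ u v z * w u v z) ^ 2 +
      2 * (Fintype.card I * Fintype.card J *
        ∑ u, q₁ u * ∑ v, q₂ v * ∑ z, κ u v z * w u v z ^ 2) := by
  set h : B → C → ℝ := fun u v => ∑ z, κ u v z * w u v z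
  set s : B → C → ℝ := fun u v => ∑ z, κ u v z * w u v z ^ 2
  set m₁ : ℝ := (Fintype.card I : ℝ)
  set m₂ : ℝ := (Fintype.card J : ℝ)
  have m₁0 : 0 ≤ m₁ := Nat.cast_nonneg _
  have m₂0 : 0 ≤ m₂ := Nat.cast_nonneg _
  -- averaging over `V` with `u` fixed
  have hV (u : B) : ∑ V : J → C, (∏ j, q₂ (V j)) * (∑ j, h u (V j)) ^ 2 ≤
      (m₂ * ∑ v, q₂ v * h u v) ^ 2 + m₂ * ∑ v, q₂ v * h u v ^ 2 := by
    simpa using sum_pi_prod_mul_sq_le (ι := J) (fun _ => s₂) (fun _ => h u)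
  have hV' : ∑ V : J → C, (∏ j, q₂ (V j)) * (∑ j, ∑ u, q₁ u * h u (V j)) ^ 2 ≤
      (m₂ * ∑ v, q₂ v * ∑ u, q₁ u * h u v) ^ 2 +
        m₂ * ∑ v, q₂ v * (∑ u, q₁ u * h u v) ^ 2 := by
    simpa using sum_pi_prod_mul_sq_le (ι := J) (fun _ => s₂)
      (fun _ v => ∑ u, q₁ u * h u v)
  -- averaging over `U` with `V` fixed
  have hU (V : J → C) : ∑ U : I → B, (∏ i, q₁ (U i)) * (∑ i, ∑ j, h (U i) (V j)) ^ 2 ≤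
      (m₁ * ∑ j, ∑ u, q₁ u * h u (V j)) ^ 2 + m₁ * ∑ u, q₁ u * (∑ j, h u (V j)) ^ 2 := by
    have := sum_pi_prod_mul_sq_le (ι := I) (fun _ => s₁)
      (fun _ u => ∑ j, h u (V j))
    rw [Finset.sum_comm]
    simpa [Finset.mul_sum] using this
  -- averaging over `Z` with `U` and `V` fixed
  have hZ (U : I → B) (V : J → C) : ∑ Z : I × J → D, (∏ k, κ (U k.1) (V k.2) (Z k)) *
      (∑ k, w (U k.1) (V k.2) (Z k)) ^ 2 ≤
      (∑ i, ∑ j, h (U i) (V j)) ^ 2 + ∑ i, ∑ j, s (U i) (V j) := by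
    have := sum_pi_prod_mul_sq_le (ι := I × J) (q := fun k => κ (U k.1) (V k.2))
      (fun _ => sκ _ _) (fun k => w (U k.1) (V k.2))
    simpa only [Fintype.sum_prod_type] using this
  have hlin : ∑ U : I → B, (∏ i, q₁ (U i)) * ∑ V : J → C, (∏ j, q₂ (V j)) *
      ∑ i, ∑ j, s (U i) (V j) = m₁ * m₂ * ∑ u, q₁ u * ∑ v, q₂ v * s u v := by
    have e (U : I → B) : ∑ V : J → C, (∏ j, q₂ (V j)) * ∑ i, ∑ j, s (U i) (V j) =
        ∑ i, m₂ * ∑ v, q₂ v * s (U i) v := by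
      rw [← Finset.mul_sum, Finset.mul_sum]
      have := fun i => sum_pi_prod_mul_sum (ι := J) (fun _ => s₂) (fun _ => s (U i))
      simp only [Finset.sum_const, Finset.card_univ, nsmul_eq_mul] at this
      rw [← Finset.sum_congr rfl fun i _ => this i, Finset.sum_comm]
      simp only [Finset.mul_sum]
    have := sum_pi_prod_mul_sum (ι := I) (fun _ => s₁) (fun _ u => m₂ * ∑ v, q₂ v * s u v)
    simp only [Finset.sum_const, Finset.card_univ, nsmul_eq_mul] at this
    rw [Finset.sum_congr rfl fun U _ => congrArg _ (e U), this, mul_assoc, Finset.mul_sum (a := m₂)]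
    simp only [mul_left_comm m₂]
    rfl
  -- By this Jensen bound the coinciding-pair term from averaging over `V` is at most the one from
  -- averaging over `Z`; together they give the factor 2.
  have hsq (u : B) (v : C) : h u v ^ 2 ≤ s u v := sq_sum_mul_le (hκ u v) (sκ u v) _
  calc codebookExp q₁ q₂ κ
        (fun (U : I → B) (V : J → C) Z => (∑ k, w (U k.1) (V k.2) (Z k)) ^ 2)
      ≤ ∑ U : I → B, (∏ i, q₁ (U i)) * ∑ V : J → C, (∏ j, q₂ (V j)) *
          ((∑ i, ∑ j, h (U i) (V j)) ^ 2 + ∑ i, ∑ j, s (U i) (V j)) := by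
        unfold codebookExp
        gcongr with U _ V _
        · exact Finset.prod_nonneg fun i _ => h₁ _
        · exact Finset.prod_nonneg fun i _ => h₂ _
        · exact hZ U V
    _ = ∑ V : J → C, (∏ j, q₂ (V j)) * (∑ U : I → B, (∏ i, q₁ (U i)) *
          (∑ i, ∑ j, h (U i) (V j)) ^ 2) + m₁ * m₂ * ∑ u, q₁ u * ∑ v, q₂ v * s u v := by
        rw [← hlin]
        simp only [mul_add, Finset.sum_add_distrib]
        congr 1
        simp only [Finset.mul_sum]
        rw [Finset.sum_comm]
        simp only [mul_left_comm]
    _ ≤ ∑ V : J → C, (∏ j, q₂ (V j)) * ((m₁ * ∑ j, ∑ u, q₁ u * h u (V j)) ^ 2 +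
          m₁ * ∑ u, q₁ u * (∑ j, h u (V j)) ^ 2) +
          m₁ * m₂ * ∑ u, q₁ u * ∑ v, q₂ v * s u v := by
        gcongr with V _
        · exact Finset.prod_nonneg fun i _ => h₂ _
        · exact hU V
    _ = m₁ ^ 2 * (∑ V : J → C, (∏ j, q₂ (V j)) * (∑ j, ∑ u, q₁ u * h u (V j)) ^ 2) +
          m₁ * ∑ u, q₁ u * (∑ V : J → C, (∏ j, q₂ (V j)) * (∑ j, h u (V j)) ^ 2) +
          m₁ * m₂ * ∑ u, q₁ u * ∑ v, q₂ v * s u v := by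
        simp only [mul_add, Finset.sum_add_distrib, mul_pow]
        congr 2
        · rw [Finset.mul_sum]
          simp only [mul_left_comm]
        · simp only [Finset.mul_sum]
          rw [Finset.sum_comm]
          refine Finset.sum_congr rfl fun u _ => Finset.sum_congr rfl fun V _ => ?_
          ring
    _ ≤ m₁ ^ 2 * ((m₂ * ∑ v, q₂ v * ∑ u, q₁ u * h u v) ^ 2 +
          m₂ * ∑ v, q₂ v * (∑ u, q₁ u * h u v) ^ 2) +
          m₁ * ∑ u, q₁ u * ((m₂ * ∑ v, q₂ v * h u v) ^ 2 + m₂ * ∑ v, q₂ v * s u v) +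
          m₁ * m₂ * ∑ u, q₁ u * ∑ v, q₂ v * s u v := by
        gcongr with u _
        · exact h₁ u
        · refine (hV u).trans ?_
          gcongr with v _
          · exact h₂ v
          · exact hsq u v
    _ = _ := by
        have e : ∑ v, q₂ v * ∑ u, q₁ u * h u v = ∑ u, q₁ u * ∑ v, q₂ v * h u v := by
          simp only [Finset.mul_sum]
          rw [Finset.sum_comm]
          simp only [mul_left_comm]
        have e' : ∑ u, q₁ u * ((m₂ * ∑ v, q₂ v * h u v) ^ 2 + m₂ * ∑ v, q₂ v * s u v) =
            m₂ ^ 2 * ∑ u, q₁ u * (∑ v, q₂ v * h u v) ^ 2 +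
              m₂ * ∑ u, q₁ u * ∑ v, q₂ v * s u v := by
          rw [Finset.mul_sum, Finset.mul_sum, ← Finset.sum_add_distrib]
          refine Finset.sum_congr rfl fun u _ => ?_
          ring
        rw [e, e']
        ring

end Codebook

/-! ### One-shot covering by the second-moment method -/

section Covering

variable {I J B C D : Type*} [Fintype I] [Fintype J] [Fintype B] [Fintype C] [Fintype D]
  [DecidableEq I] [DecidableEq J]
variable {q₁ : B → ℝ} {q₂ : C → ℝ} {κ : B → C → D → ℝ}

/-- Expand the square, drop the cross term since `b ≥ 0`, and use `q * b ^ 2 ≤ d * (q * b)`. With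
`b` a likelihood ratio, domination by `d` thus bounds the variance. -/
theorem sum_mul_sub_one_sq_le {β : Type*} [Fintype β] {q b : β → ℝ} (hq0 : ∀ v, 0 ≤ q v)
    (hq : ∑ v, q v = 1) (hb : ∀ v, 0 ≤ b v) {d : ℝ} (hd0 : 0 ≤ d)
    (hd : ∀ v, q v * b v ≤ d * q v) (h1 : ∑ v, q v * b v ≤ 1) :
    ∑ v, q v * (b v - 1) ^ 2 ≤ d + 1 := by
  calc ∑ v, q v * (b v - 1) ^ 2 ≤ ∑ v, (d * (q v * b v) + q v) := by
        refine Finset.sum_le_sum fun v _ => ?_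
        have := mul_le_mul_of_nonneg_left (hd v) (hb v)
        have := mul_nonneg (hq0 v) (hb v)
        nlinarith
    _ = d * ∑ v, q v * b v + 1 := by rw [Finset.sum_add_distrib, hq, Finset.mul_sum]
    _ ≤ d + 1 := by nlinarith

/-- Weighted mutual covering with superposition: if `W` is a subprobability of mass `μ` that is
dominated by the codebook law, jointly and in its marginals, then a random codebook misses the
support of `W` with probability at most `1 - μ` up to an error controlled by the codebook sizes. -/
theorem codebookExp_miss_le [Nonempty I] [Nonempty J] (h₁ : ∀ u, 0 ≤ q₁ u)
    (s₁ : ∑ u, q₁ u = 1) (h₂ : ∀ v, 0 ≤ q₂ v) (s₂ : ∑ v, q₂ v = 1)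
    (hκ : ∀ u v z, 0 ≤ κ u v z) (sκ : ∀ u v, ∑ z, κ u v z = 1) {W : B → C → D → ℝ}
    (hW : ∀ u v z, 0 ≤ W u v z) (hW1 : ∑ u, ∑ v, ∑ z, W u v z ≤ 1) {d d₁ d₂ : ℝ}
    (hd0 : 0 ≤ d) (hd₁0 : 0 ≤ d₁) (hd₂0 : 0 ≤ d₂)
    (hd : ∀ u v z, W u v z ≤ d * (q₁ u * q₂ v * κ u v z))
    (hd₁ : ∀ u, ∑ v, ∑ z, W u v z ≤ d₁ * q₁ u)
    (hd₂ : ∀ v, ∑ u, ∑ z, W u v z ≤ d₂ * q₂ v)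
    {miss : (I → B) → (J → C) → (I × J → D) → ℝ} (hm1 : ∀ U V Z, miss U V Z ≤ 1)
    (hm0 : ∀ U V Z k, W (U k.1) (V k.2) (Z k) ≠ 0 → miss U V Z ≤ 0) :
    codebookExp q₁ q₂ κ miss ≤ 1 - ∑ u, ∑ v, ∑ z, W u v z + (d₂ + 1) / Fintype.card J +
      (d₁ + 1) / Fintype.card I + 2 * (d + 1) / (Fintype.card I * Fintype.card J) := by
  set m₁ : ℝ := (Fintype.card I : ℝ) with hm₁
  set m₂ : ℝ := (Fintype.card J : ℝ) with hm₂
  have m₁0 : 0 < m₁ := Nat.cast_pos.2 Fintype.card_pos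
  have m₂0 : 0 < m₂ := Nat.cast_pos.2 Fintype.card_pos
  -- Likelihood ratio against the codebook law. Where the denominator is 0, `hd` forces `W` to be 0
  -- too, so the default quotient 0 does no harm.
  set w : B → C → D → ℝ := fun u v z => W u v z / (q₁ u * q₂ v * κ u v z) with hw
  have hr0 (u v z) : 0 ≤ q₁ u * q₂ v * κ u v z := mul_nonneg (mul_nonneg (h₁ _) (h₂ _)) (hκ _ _ _)
  have hw0 (u v z) : 0 ≤ w u v z := div_nonneg (hW _ _ _) (hr0 _ _ _)
  have hwW (u v z) : q₁ u * q₂ v * κ u v z * w u v z = W u v z := by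
    by_cases h : q₁ u * q₂ v * κ u v z = 0
    · have := hd u v z
      rw [h, mul_zero] at this
      rw [h, zero_mul, le_antisymm this (hW u v z)]
    · exact mul_div_cancel₀ _ h
  set μ := ∑ u, ∑ v, ∑ z, W u v z with hμ
  have hμ0 : 0 ≤ μ := Finset.sum_nonneg fun u _ => Finset.sum_nonneg fun v _ =>
    Finset.sum_nonneg fun z _ => hW u v z
  set a : B → ℝ := fun u => ∑ v, q₂ v * ∑ z, κ u v z * w u v z with ha
  set b : C → ℝ := fun v => ∑ u, q₁ u * ∑ z, κ u v z * w u v z with hb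
  have ha0 (u) : 0 ≤ a u := Finset.sum_nonneg fun v _ => mul_nonneg (h₂ v) <|
    Finset.sum_nonneg fun z _ => mul_nonneg (hκ _ _ _) (hw0 _ _ _)
  have hb0 (v) : 0 ≤ b v := Finset.sum_nonneg fun u _ => mul_nonneg (h₁ u) <|
    Finset.sum_nonneg fun z _ => mul_nonneg (hκ _ _ _) (hw0 _ _ _)
  have haW (u) : q₁ u * a u = ∑ v, ∑ z, W u v z := by
    simp only [ha, Finset.mul_sum]
    refine Finset.sum_congr rfl fun v _ => Finset.sum_congr rfl fun z _ => ?_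
    rw [← hwW]
    ring
  have hbW (v) : q₂ v * b v = ∑ u, ∑ z, W u v z := by
    simp only [hb, Finset.mul_sum]
    refine Finset.sum_congr rfl fun u _ => Finset.sum_congr rfl fun z _ => ?_
    rw [← hwW]
    ring
  have hsa : ∑ u, q₁ u * a u = μ := Finset.sum_congr rfl fun u _ => haW u
  have hsb : ∑ v, q₂ v * b v = μ := by
    rw [hμ, Finset.sum_comm]
    exact Finset.sum_congr rfl fun v _ => hbW v
  have ea (u) : ∑ v, q₂ v * ∑ z, κ u v z * (w u v z - 1) = a u - 1 := by
    simp only [mul_sub, mul_one, Finset.sum_sub_distrib, sκ, s₂, ha]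
  have eb (v) : ∑ u, q₁ u * ∑ z, κ u v z * (w u v z - 1) = b v - 1 := by
    simp only [mul_sub, mul_one, Finset.sum_sub_distrib, sκ, s₁, hb]
  have A₁ : ∑ u, q₁ u * (a u - 1) ^ 2 ≤ d₁ + 1 :=
    sum_mul_sub_one_sq_le h₁ s₁ ha0 hd₁0 (fun u => (haW u).trans_le (hd₁ u)) (hsa.trans_le hW1)
  have A₂ : ∑ v, q₂ v * (b v - 1) ^ 2 ≤ d₂ + 1 :=
    sum_mul_sub_one_sq_le h₂ s₂ hb0 hd₂0 (fun v => (hbW v).trans_le (hd₂ v)) (hsb.trans_le hW1)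
  have A : ∑ u, q₁ u * ∑ v, q₂ v * ∑ z, κ u v z * (w u v z - 1) ^ 2 ≤ d + 1 := by
    have := sum_mul_sub_one_sq_le (β := B × C × D)
      (q := fun s => q₁ s.1 * q₂ s.2.1 * κ s.1 s.2.1 s.2.2) (b := fun s => w s.1 s.2.1 s.2.2)
      (fun s => hr0 _ _ _) (by
        simp only [Fintype.sum_prod_type, ← Finset.mul_sum, sκ, mul_one, s₂, s₁])
      (fun s => hw0 _ _ _) hd0 (fun s => (hwW _ _ _).trans_le (hd _ _ _)) (by
        simpa only [Fintype.sum_prod_type, hwW] using hW1)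
    simpa only [Fintype.sum_prod_type, mul_assoc, ← Finset.mul_sum] using this
  -- The squared bias is `(1 - μ) ^ 2 ≤ 1 - μ` because `0 ≤ μ ≤ 1`.
  have aμ : (m₁ * m₂ * ∑ u, q₁ u * ∑ v, q₂ v * ∑ z, κ u v z * (w u v z - 1)) ^ 2 ≤
      (m₁ * m₂) ^ 2 * (1 - μ) := by
    simp only [ea]
    rw [Finset.sum_congr rfl fun u _ => mul_sub_one (q₁ u) (a u), Finset.sum_sub_distrib, hsa, s₁,
      mul_pow]
    gcongr
    nlinarith
  have key := codebookExp_sq_sum_le (I := I) (J := J) h₁ s₁ h₂ s₂ hκ sκ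
    (fun u v z => w u v z - 1)
  simp only [eb] at key
  -- Chebyshev: on a miss every ratio is 0, so the sum centred at 1 equals `-(m₁ * m₂)`.
  have hmiss : codebookExp q₁ q₂ κ miss ≤ codebookExp q₁ q₂ κ
      (fun (U : I → B) (V : J → C) Z =>
        (∑ k, (w (U k.1) (V k.2) (Z k) - 1)) ^ 2 * ((m₁ * m₂) ^ 2)⁻¹) := by
    refine codebookExp_mono h₁ h₂ hκ fun U V Z => ?_
    by_cases h : ∃ k : I × J, W (U k.1) (V k.2) (Z k) ≠ 0
    · obtain ⟨k, hk⟩ := h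
      exact (hm0 U V Z k hk).trans (by positivity)
    · push Not at h
      refine (hm1 U V Z).trans (le_of_eq ?_)
      have : ∑ k : I × J, (w (U k.1) (V k.2) (Z k) - 1) = -(m₁ * m₂) := by
        simp [hw, h, hm₁, hm₂]
      rw [this, neg_sq, mul_inv_cancel₀ (by positivity)]
  rw [codebookExp_mul_right] at hmiss
  refine hmiss.trans ?_
  rw [← div_eq_mul_inv, div_le_iff₀ (by positivity)]
  refine (key.trans (add_le_add (add_le_add (add_le_add aμ
    (mul_le_mul_of_nonneg_left A₂ (by positivity)))
    (mul_le_mul_of_nonneg_left ?_ (by positivity)))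
    (mul_le_mul_of_nonneg_left (mul_le_mul_of_nonneg_left A (by positivity)) (by norm_num)))).trans
    (le_of_eq (?_ : _ + m₁ ^ 2 * m₂ * (d₂ + 1) + m₁ * m₂ ^ 2 * (d₁ + 1) +
      2 * (m₁ * m₂ * (d + 1)) = _))
  · simpa only [ea] using A₁
  · field_simp

open Classical in
/-- One-shot covering: some codebook misses the set `T` with small probability. -/
theorem exists_codebook {A : Type*} [Fintype A] [Nonempty I] [Nonempty J] {p : A → ℝ}
    (hp : ∀ x, 0 ≤ p x) (sp : ∑ x, p x = 1) (h₁ : ∀ u, 0 ≤ q₁ u)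
    (s₁ : ∑ u, q₁ u = 1) (h₂ : ∀ v, 0 ≤ q₂ v) (s₂ : ∑ v, q₂ v = 1)
    (hκ : ∀ u v z, 0 ≤ κ u v z) (sκ : ∀ u v, ∑ z, κ u v z = 1) {W : A → B → C → D → ℝ}
    (hW : ∀ x u v z, 0 ≤ W x u v z) (sW : ∀ x, ∑ u, ∑ v, ∑ z, W x u v z = 1)
    (T : A → B → C → D → Prop) {d d₁ d₂ : ℝ}
    (hd0 : 0 ≤ d) (hd₁0 : 0 ≤ d₁) (hd₂0 : 0 ≤ d₂)
    (hd : ∀ x u v z, T x u v z → W x u v z ≤ d * (q₁ u * q₂ v * κ u v z))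
    (hd₁ : ∀ x u v z, T x u v z → ∑ v, ∑ z, W x u v z ≤ d₁ * q₁ u)
    (hd₂ : ∀ x u v z, T x u v z → ∑ u, ∑ z, W x u v z ≤ d₂ * q₂ v) :
    ∃ (U : I → B) (V : J → C) (Z : I × J → D),
      ∑ x, p x * (if ∃ k : I × J, T x (U k.1) (V k.2) (Z k) then 0 else 1) ≤
        ∑ x, p x * (∑ u, ∑ v, ∑ z, W x u v z * if T x u v z then 0 else 1) +
        ((d₂ + 1) / Fintype.card J +
          (d₁ + 1) / Fintype.card I + 2 * (d + 1) / (Fintype.card I * Fintype.card J)) := by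
  apply exists_le_of_codebookExp_le h₁ s₁ h₂ s₂ hκ sκ
  rw [codebookExp_sum]
  set r := (d₂ + 1) / (Fintype.card J : ℝ) + (d₁ + 1) / Fintype.card I +
    2 * (d + 1) / (Fintype.card I * Fintype.card J) with hr
  have hr1 : r = ∑ x, p x * r := by rw [← Finset.sum_mul, sp, one_mul]
  rw [hr1, ← Finset.sum_add_distrib]
  refine Finset.sum_le_sum fun x _ => ?_
  rw [← mul_add]
  refine mul_le_mul_of_nonneg_left ?_ (hp x)
  have hle (u v z) : (if T x u v z then W x u v z else 0) ≤ W x u v z := by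
    split_ifs
    exacts [le_rfl, hW x u v z]
  have e : ∑ u, ∑ v, ∑ z, (W x u v z * if T x u v z then 0 else 1) =
      1 - ∑ u, ∑ v, ∑ z, if T x u v z then W x u v z else 0 := by
    rw [eq_sub_iff_add_eq]
    refine Eq.trans ?_ (sW x)
    simp only [← Finset.sum_add_distrib]
    refine Finset.sum_congr rfl fun u _ => Finset.sum_congr rfl fun v _ =>
      Finset.sum_congr rfl fun z _ => ?_
    split_ifs <;> simp
  rw [e, hr, ← add_assoc, ← add_assoc]
  -- Truncating `W` to `T` makes domination on `T` sufficient: a `u` or `v` that occurs in no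
  -- element of `T` has truncated marginal 0.
  refine codebookExp_miss_le (W := fun u v z => if T x u v z then W x u v z else 0)
    h₁ s₁ h₂ s₂ hκ sκ ?_ ?_ hd0 hd₁0 hd₂0 ?_ ?_ ?_ ?_ ?_
  · intro u v z
    split_ifs
    exacts [hW x u v z, le_rfl]
  · rw [← sW x]
    exact Finset.sum_le_sum fun u _ => Finset.sum_le_sum fun v _ =>
      Finset.sum_le_sum fun z _ => hle u v z
  · intro u v z
    split_ifs with h
    · exact hd x u v z h
    · exact mul_nonneg hd0 (mul_nonneg (mul_nonneg (h₁ _) (h₂ _)) (hκ _ _ _))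
  · intro u
    by_cases h : ∃ v z, T x u v z
    · obtain ⟨v, z, h⟩ := h
      refine le_trans ?_ (hd₁ x u v z h)
      exact Finset.sum_le_sum fun v _ => Finset.sum_le_sum fun z _ => hle u v z
    · push Not at h
      simpa [h] using mul_nonneg hd₁0 (h₁ u)
  · intro v
    by_cases h : ∃ u z, T x u v z
    · obtain ⟨u, z, h⟩ := h
      refine le_trans ?_ (hd₂ x u v z h)
      exact Finset.sum_le_sum fun u _ => Finset.sum_le_sum fun z _ => hle u v z
    · push Not at h
      simpa [h] using mul_nonneg hd₂0 (h₂ v)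
  · intro U V Z
    split_ifs <;> norm_num
  · intro U V Z k h
    rw [if_pos ⟨k, by by_contra hT; simp [hT] at h⟩]

end Covering

/-! ### Law of large numbers -/

open Classical in
/-- Weak law of large numbers, uniformly over finitely many functions on a finite alphabet. -/
theorem sum_atypical_le {ι α : Type*} [Fintype ι] [Fintype α] {p : α → ℝ} (hp : ∀ a, 0 ≤ p a)
    (sp : ∑ a, p a = 1) (f : ι → α → ℝ) {ε : ℝ} (hε : 0 < ε) {n : ℕ} (hn : 0 < n) :
    ∑ s : Fin n → α, (∏ k, p (s k)) *
        (if (∀ k, p (s k) ≠ 0) ∧ ∀ i, |∑ k, f i (s k) - n * ∑ a, p a * f i a| ≤ n * ε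
          then 0 else 1) ≤
      (∑ i, ∑ a, p a * (f i a - ∑ a, p a * f i a) ^ 2) / ε ^ 2 / n := by
  set m : ι → ℝ := fun i => ∑ a, p a * f i a with hm
  have hn' : (0 : ℝ) < n := Nat.cast_pos.2 hn
  have hsum (i : ι) (s : Fin n → α) :
      ∑ k, f i (s k) - n * m i = ∑ k, (f i (s k) - m i) := by simp
  calc _ ≤ ∑ s : Fin n → α, (∏ k, p (s k)) *
        ∑ i, (∑ k, (f i (s k) - m i)) ^ 2 * ((n * ε) ^ 2)⁻¹ := by
        refine Finset.sum_le_sum fun s _ => ?_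
        -- A sequence through a letter of mass 0 has weight 0, so demanding full support costs
        -- nothing.
        by_cases h0 : ∀ k, p (s k) ≠ 0
        · refine mul_le_mul_of_nonneg_left ?_ (Finset.prod_nonneg fun k _ => hp _)
          have hterm (i) : 0 ≤ (∑ k, (f i (s k) - m i)) ^ 2 * (((n : ℝ) * ε) ^ 2)⁻¹ := by
            positivity
          split_ifs with h
          · exact Finset.sum_nonneg fun i _ => hterm i
          · obtain ⟨i, hi⟩ : ∃ i, (n : ℝ) * ε < |∑ k, f i (s k) - n * m i| := by
              by_contra! hc
              exact h ⟨h0, hc⟩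
            refine le_trans ?_ (Finset.single_le_sum (fun i _ => hterm i) (Finset.mem_univ i))
            rw [hsum] at hi
            rw [← div_eq_mul_inv, one_le_div (by positivity), ← sq_abs (∑ k, _)]
            gcongr
        · push Not at h0
          obtain ⟨k, hk⟩ := h0
          rw [Finset.prod_eq_zero (f := fun k => p (s k)) (Finset.mem_univ k) hk]
          simp
    _ = (∑ i, ∑ s : Fin n → α, (∏ k, p (s k)) * (∑ k, (f i (s k) - m i)) ^ 2) *
          ((n * ε) ^ 2)⁻¹ := by
        simp only [← Finset.sum_mul, ← mul_assoc, Finset.mul_sum]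
        rw [Finset.sum_comm]
    _ ≤ (∑ i, n * ∑ a, p a * (f i a - m i) ^ 2) * ((n * ε) ^ 2)⁻¹ := by
        refine mul_le_mul_of_nonneg_right (Finset.sum_le_sum fun i _ => ?_) (by positivity)
        have h := sum_pi_prod_mul_sq_le (ι := Fin n) (q := fun _ => p) (fun _ => sp)
          (fun _ a => f i a - m i)
        have h0 : ∑ a, p a * (f i a - m i) = 0 := by
          simp only [mul_sub, Finset.sum_sub_distrib, ← Finset.sum_mul, sp, one_mul, hm, sub_self]
        simpa [h0] using h
    _ = _ := by
        rw [← Finset.mul_sum]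
        field_simp
        rfl

/-! ### Real-valued masses and information density -/

section Mass

variable {α β γ : Type*}

theorem mass_nonneg (p : PMF α) (a : α) : 0 ≤ mass p a := ENNReal.toReal_nonneg

theorem sum_mass [Fintype α] (p : PMF α) : ∑ a, mass p a = 1 := by
  have h := p.tsum_coe
  rw [tsum_fintype] at h
  simp only [mass]
  rw [← ENNReal.toReal_sum fun a _ => p.apply_ne_top a, h, ENNReal.toReal_one]

open Classical in
theorem mass_map [Fintype α] (p : PMF α) (g : α → β) (c : β) :
    mass (p.map g) c = ∑ a, if c = g a then mass p a else 0 := by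
  simp only [mass, PMF.map_apply, tsum_fintype]
  rw [ENNReal.toReal_sum fun a _ => by split_ifs <;> simp [p.apply_ne_top]]
  exact Finset.sum_congr rfl fun a _ => by split_ifs <;> simp

theorem sum_mass_map_mul [Fintype α] [Fintype β] (p : PMF α) (g : α → β) (f : β → ℝ) :
    ∑ c, mass (p.map g) c * f c = ∑ a, mass p a * f (g a) := by
  classical
  simp only [mass_map, Finset.sum_mul]
  rw [Finset.sum_comm]
  exact Finset.sum_congr rfl fun a _ => by simp [ite_mul]

theorem mass_le_mass_map [Fintype α] (p : PMF α) (g : α → β) (a : α) :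
    mass p a ≤ mass (p.map g) (g a) := by
  classical
  rw [mass_map]
  refine le_trans ?_ (Finset.single_le_sum (f := fun b => if g a = g b then mass p b else 0)
    (fun b _ => ?_) (Finset.mem_univ a))
  · simp
  · split_ifs
    exacts [mass_nonneg p b, le_rfl]

theorem mass_map_ne_zero [Fintype α] {p : PMF α} (g : α → β) {a : α} (h : mass p a ≠ 0) :
    mass (p.map g) (g a) ≠ 0 :=
  (((mass_nonneg p a).lt_of_ne' h).trans_le (mass_le_mass_map p g a)).ne'

theorem mass_joint [Fintype α] (p : PMF α) (W : α → PMF β) (a : α) (b : β) :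
    mass (joint p W) (a, b) = mass p a * mass (W a) b := by
  classical
  have h (a' : α) : ((W a').map fun b => (a', b)) (a, b) = if a' = a then W a b else 0 := by
    rw [PMF.map_apply]
    split_ifs with h
    · subst h
      rw [tsum_eq_single b fun b' hb => by simp [hb.symm]]
      simp
    · simp [Ne.symm h]
  simp [mass, joint, PMF.bind_apply, h]

theorem map_joint (p : PMF α) (W : α → PMF β) (f : β → γ) :
    (joint p W).map (fun s => (s.1, f s.2)) = joint p (condMap W f) := by
  simp only [joint, condMap, PMF.map_bind, PMF.map_comp]
  rfl

theorem map_fst_joint (p : PMF α) (W : α → PMF β) : (joint p W).map Prod.fst = p := by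
  simp only [joint, PMF.map_bind, PMF.map_comp]
  have (a : α) : (W a).map (Prod.fst ∘ fun b => (a, b)) = PMF.pure a := PMF.map_const _ a
  simp only [this, PMF.bind_pure]

theorem map_snd_joint (p : PMF α) (W : α → PMF β) : (joint p W).map Prod.snd = p.bind W := by
  simp only [joint, PMF.map_bind, PMF.map_comp]
  have (a : α) : (W a).map (Prod.snd ∘ fun b => (a, b)) = W a := PMF.map_id _
  simp only [this]

/-- Information density, in nats, of a joint PMF. -/
noncomputable def infoDensity [Fintype α] [Fintype β] (p : PMF (α × β)) (s : α × β) : ℝ :=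
  Real.log (mass p s / (mass (p.map Prod.fst) s.1 * mass (p.map Prod.snd) s.2))

theorem mutualInfo_eq [Fintype α] [Fintype β] (p : PMF (α × β)) :
    mutualInfo p = ∑ s, mass p s * infoDensity p s := by
  rw [Fintype.sum_prod_type]
  rfl

/-- At a point of mass 0 the logarithm takes its default value 0 and the identity can fail; this is
why typical sequences must avoid such letters. -/
theorem mass_eq_exp_infoDensity_mul [Fintype α] [Fintype β] {p : PMF (α × β)} {s : α × β}
    (h : mass p s ≠ 0) : mass p s =
      Real.exp (infoDensity p s) * (mass (p.map Prod.fst) s.1 * mass (p.map Prod.snd) s.2) := by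
  have h1 := (mass_nonneg _ _).lt_of_ne' (mass_map_ne_zero Prod.fst h)
  have h2 := (mass_nonneg _ _).lt_of_ne' (mass_map_ne_zero Prod.snd h)
  have h0 := (mass_nonneg _ _).lt_of_ne' h
  rw [infoDensity, Real.exp_log (by positivity), div_mul_cancel₀ _ (by positivity)]

/-- From `exp (-i) ≥ 1 - i` for the density `i`, each term is at least the joint mass minus the
product mass, and these differences sum to 0. -/
theorem mutualInfo_nonneg [Fintype α] [Fintype β] (p : PMF (α × β)) : 0 ≤ mutualInfo p := by
  rw [mutualInfo_eq]
  have h (s : α × β) : mass p s - mass (p.map Prod.fst) s.1 * mass (p.map Prod.snd) s.2 ≤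
      mass p s * infoDensity p s := by
    have hq := mul_nonneg (mass_nonneg (p.map Prod.fst) s.1) (mass_nonneg (p.map Prod.snd) s.2)
    by_cases h : mass p s = 0
    · rw [h, zero_mul]
      linarith
    · have h0 := (mass_nonneg _ _).lt_of_ne' h
      have e : mass (p.map Prod.fst) s.1 * mass (p.map Prod.snd) s.2 =
          mass p s * Real.exp (-infoDensity p s) := by
        conv_rhs => rw [mass_eq_exp_infoDensity_mul h]
        rw [mul_right_comm, ← Real.exp_add, add_neg_cancel, Real.exp_zero, one_mul]
      rw [e]
      nlinarith [Real.add_one_le_exp (-infoDensity p s)]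
  refine le_trans (le_of_eq ?_) (Finset.sum_le_sum fun s _ => h s)
  rw [Finset.sum_sub_distrib, sum_mass, Fintype.sum_prod_type]
  simp only [← Finset.mul_sum, sum_mass, mul_one, sub_self]

end Mass

/-! ### Total variation and joint types -/

section TV

variable {α β : Type*} [Fintype α] [Fintype β]

theorem tv_nonneg (p q : α → ℝ) : 0 ≤ tv p q := by
  unfold tv
  positivity

theorem tv_triangle (p q r : α → ℝ) : tv p r ≤ tv p q + tv q r := by
  unfold tv
  rw [← mul_add, ← Finset.sum_add_distrib]
  gcongr
  exact abs_sub_le _ _ _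

theorem tv_comm (p q : α → ℝ) : tv p q = tv q p := by
  simp only [tv, abs_sub_comm]

theorem sum_jointType {n : ℕ} (hn : 0 < n) (x : Fin n → α) (y : Fin n → β) :
    ∑ c, jointType x y c = 1 := by
  classical
  simp only [jointType, ← Finset.mul_sum]
  rw [Finset.sum_comm]
  simp only [Finset.sum_ite_eq, Finset.mem_univ, if_true]
  simp [hn.ne']

theorem tv_jointType_le_one {n : ℕ} (hn : 0 < n) (x : Fin n → α) (y : Fin n → β)
    (p : PMF (α × β)) : tv (jointType x y) (mass p) ≤ 1 := by
  have h (c) : |jointType x y c - mass p c| ≤ jointType x y c + mass p c := by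
    have h1 : 0 ≤ jointType x y c := by
      unfold jointType
      positivity
    have h2 := mass_nonneg p c
    rw [abs_le]
    constructor <;> linarith
  have := Finset.sum_le_sum fun c (_ : c ∈ Finset.univ) => h c
  rw [Finset.sum_add_distrib, sum_jointType hn, sum_mass] at this
  unfold tv
  linarith

open Classical in
theorem tv_jointType_le {n : ℕ} (hn : 0 < n) (x : Fin n → α) (y : Fin n → β)
    (p : PMF (α × β)) {ε : ℝ} (h : ∀ c, |(∑ k, if (x k, y k) = c then (1 : ℝ) else 0) -
      n * mass p c| ≤ n * ε) : tv (jointType x y) (mass p) ≤ Fintype.card (α × β) * ε := by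
  have hn' : (0 : ℝ) < n := Nat.cast_pos.2 hn
  have h' (c) : |jointType x y c - mass p c| ≤ ε := by
    have e : jointType x y c - mass p c =
        ((∑ k, if (x k, y k) = c then (1 : ℝ) else 0) - n * mass p c) / n := by
      rw [jointType]
      field_simp
    rw [e, abs_div, abs_of_pos hn', div_le_iff₀ hn', mul_comm ε]
    exact h c
  have hs := Finset.sum_le_sum fun c (_ : c ∈ Finset.univ) => h' c
  have h0 : 0 ≤ ∑ c, |jointType x y c - mass p c| := by positivity
  rw [Finset.sum_const, Finset.card_univ, nsmul_eq_mul] at hs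
  unfold tv
  linarith

end TV

theorem sum_arrow_prod {κ α β : Type*} [Fintype κ] [DecidableEq κ] [Fintype α] [Fintype β]
    (F : (κ → α × β) → ℝ) : ∑ s, F s = ∑ x : κ → α, ∑ y : κ → β, F fun k => (x k, y k) := by
  rw [← Fintype.sum_prod_type' (f := fun (x : κ → α) (y : κ → β) => F fun k => (x k, y k))]
  exact Fintype.sum_equiv (Equiv.arrowProdEquivProdArrow κ (fun _ => α) (fun _ => β)) _ _ fun s => rfl

/-! ### Typical sequences of the test channel -/

section TestChannel

variable {𝕏 𝕐 : Type*} [Fintype 𝕏] [Fintype 𝕐]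

/-- The `i`-th reconstruction letter. -/
def recon (i : Fin 3) (y : 𝕐 × 𝕐 × 𝕐) : 𝕐 :=
  match i with
  | 0 => y.1
  | 1 => y.2.1
  | 2 => y.2.2

open Classical in
/-- Conditional law of the third letter given the first two. -/
noncomputable def thirdLaw (p : PMF (𝕐 × 𝕐 × 𝕐)) (u v z : 𝕐) : ℝ :=
  if mass (p.map fun y => (y.1, y.2.1)) (u, v) = 0 then mass (p.map fun y => y.2.2) z
  else mass p (u, v, z) / mass (p.map fun y => (y.1, y.2.1)) (u, v)

omit [Fintype 𝕐] in
theorem thirdLaw_nonneg (p : PMF (𝕐 × 𝕐 × 𝕐)) (u v z : 𝕐) : 0 ≤ thirdLaw p u v z := by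
  unfold thirdLaw
  split_ifs
  · exact mass_nonneg _ _
  · exact div_nonneg (mass_nonneg _ _) (mass_nonneg _ _)

theorem mass_map_pair (p : PMF (𝕐 × 𝕐 × 𝕐)) (u v : 𝕐) :
    mass (p.map fun y => (y.1, y.2.1)) (u, v) = ∑ z, mass p (u, v, z) := by
  classical
  simp only [mass_map, Fintype.sum_prod_type, Prod.mk.injEq]
  rw [Finset.sum_eq_single u, Finset.sum_eq_single v]
  · simp
  · intro v' _ hv
    simp [hv.symm]
  · simp
  · intro u' _ hu
    simp [hu.symm]
  · simp

theorem mass_map_fst (p : PMF (𝕐 × 𝕐 × 𝕐)) (u : 𝕐) :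
    mass (p.map fun y => y.1) u = ∑ v, ∑ z, mass p (u, v, z) := by
  classical
  simp only [mass_map, Fintype.sum_prod_type]
  rw [Finset.sum_eq_single u]
  · simp
  · intro u' _ hu
    simp [hu.symm]
  · simp

theorem mass_map_snd_fst (p : PMF (𝕐 × 𝕐 × 𝕐)) (v : 𝕐) :
    mass (p.map fun y => y.2.1) v = ∑ u, ∑ z, mass p (u, v, z) := by
  classical
  simp only [mass_map, Fintype.sum_prod_type]
  refine Finset.sum_congr rfl fun u _ => ?_
  rw [Finset.sum_eq_single v]
  · simp
  · intro v' _ hv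
    simp [hv.symm]
  · simp

/-- The random codebook needs a kernel normalised at every pair, including pairs of mass 0, which
independent words can hit. The default branch of `thirdLaw` is there for this. -/
theorem sum_thirdLaw (p : PMF (𝕐 × 𝕐 × 𝕐)) (u v : 𝕐) : ∑ z, thirdLaw p u v z = 1 := by
  unfold thirdLaw
  split_ifs with h
  · exact sum_mass _
  · rw [← Finset.sum_div, ← mass_map_pair, div_self h]

theorem mass_map_pair_mul_thirdLaw {p : PMF (𝕐 × 𝕐 × 𝕐)} {y : 𝕐 × 𝕐 × 𝕐} (hy : mass p y ≠ 0) :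
    mass p y = mass (p.map fun y => (y.1, y.2.1)) (y.1, y.2.1) * thirdLaw p y.1 y.2.1 y.2.2 := by
  have h := mass_map_ne_zero (fun y : 𝕐 × 𝕐 × 𝕐 => (y.1, y.2.1)) hy
  rw [thirdLaw, if_neg h, mul_div_cancel₀ _ h]

variable (p₀ : PMF 𝕏) (Q : 𝕏 → PMF (𝕐 × 𝕐 × 𝕐))

theorem mass_condMap_eq_exp_mul (f : 𝕐 × 𝕐 × 𝕐 → 𝕐) {s : 𝕏 × 𝕐 × 𝕐 × 𝕐}
    (hs : mass (joint p₀ Q) s ≠ 0) : mass ((Q s.1).map f) (f s.2) =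
      Real.exp (infoDensity (joint p₀ (condMap Q f)) (s.1, f s.2)) *
        mass ((p₀.bind Q).map f) (f s.2) := by
  have h := mass_map_ne_zero (fun s : 𝕏 × 𝕐 × 𝕐 × 𝕐 => (s.1, f s.2)) hs
  rw [map_joint] at h
  have e := mass_eq_exp_infoDensity_mul h
  have hx : mass p₀ s.1 ≠ 0 := by
    have := mass_map_ne_zero Prod.fst hs
    rwa [map_fst_joint] at this
  have hb : p₀.bind (condMap Q f) = (p₀.bind Q).map f := by
    rw [PMF.map_bind]
    rfl
  rw [map_fst_joint, map_snd_joint, mass_joint, mul_left_comm, hb] at e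
  exact mul_left_cancel₀ hx e

/-- Information density of the codebook law with respect to the test channel. -/
noncomputable def totalDensity (s : 𝕏 × 𝕐 × 𝕐 × 𝕐) : ℝ :=
  infoDensity (joint p₀ Q) s +
    infoDensity ((p₀.bind Q).map fun y => (y.1, y.2.1)) (s.2.1, s.2.2.1)

/-- Two changes of measure: from `Q` to the output law, costing the density between input and all
outputs; then, after splitting off the third letter by the chain rule, from the pair law to the
product of its marginals, costing the density between the first two letters. -/
theorem mass_eq_exp_totalDensity_mul {s : 𝕏 × 𝕐 × 𝕐 × 𝕐} (hs : mass (joint p₀ Q) s ≠ 0) :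
    mass (Q s.1) s.2 = Real.exp (totalDensity p₀ Q s) *
      (mass ((p₀.bind Q).map fun y => y.1) s.2.1 *
        mass ((p₀.bind Q).map fun y => y.2.1) s.2.2.1 *
        thirdLaw (p₀.bind Q) s.2.1 s.2.2.1 s.2.2.2) := by
  have e := mass_eq_exp_infoDensity_mul hs
  have hx : mass p₀ s.1 ≠ 0 := by
    have := mass_map_ne_zero Prod.fst hs
    rwa [map_fst_joint] at this
  have hy : mass (p₀.bind Q) s.2 ≠ 0 := by
    have := mass_map_ne_zero Prod.snd hs
    rwa [map_snd_joint] at this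
  rw [map_fst_joint, map_snd_joint, mass_joint, mul_left_comm] at e
  rw [mul_left_cancel₀ hx e, mass_map_pair_mul_thirdLaw hy, mass_eq_exp_infoDensity_mul
    (mass_map_ne_zero (fun y : 𝕐 × 𝕐 × 𝕐 => (y.1, y.2.1)) hy), PMF.map_comp, PMF.map_comp,
    totalDensity, Real.exp_add]
  simp only [Function.comp_def]
  ring

theorem sum_mass_mul_infoDensity (f : 𝕐 × 𝕐 × 𝕐 → 𝕐) :
    ∑ s, mass (joint p₀ Q) s * infoDensity (joint p₀ (condMap Q f)) (s.1, f s.2) =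
      mutualInfo (joint p₀ (condMap Q f)) := by
  rw [mutualInfo_eq, ← map_joint, sum_mass_map_mul]

theorem sum_mass_mul_totalDensity :
    ∑ s, mass (joint p₀ Q) s * totalDensity p₀ Q s =
      mutualInfo (joint p₀ Q) + mutualInfo ((p₀.bind Q).map fun y => (y.1, y.2.1)) := by
  rw [mutualInfo_eq, mutualInfo_eq, sum_mass_map_mul, ← map_snd_joint, sum_mass_map_mul,
    ← Finset.sum_add_distrib]
  refine Finset.sum_congr rfl fun s _ => ?_
  rw [totalDensity, mul_add, map_snd_joint]

open Classical in
/-- The statistics whose sample averages are controlled on the typical set. -/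
noncomputable def statistic : Fin 3 ⊕ Fin 3 × 𝕏 × 𝕐 → 𝕏 × 𝕐 × 𝕐 × 𝕐 → ℝ
  | .inl 0, s => infoDensity (joint p₀ (condMap Q fun y => y.1)) (s.1, s.2.1)
  | .inl 1, s => infoDensity (joint p₀ (condMap Q fun y => y.2.1)) (s.1, s.2.2.1)
  | .inl 2, s => totalDensity p₀ Q s
  | .inr (i, c), s => if (s.1, recon i s.2) = c then 1 else 0

/-- Typical sequences of joint letters. -/
def Typical (ε : ℝ) {n : ℕ} (s : Fin n → 𝕏 × 𝕐 × 𝕐 × 𝕐) : Prop :=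
  (∀ k, mass (joint p₀ Q) (s k) ≠ 0) ∧ ∀ i, |∑ k, statistic p₀ Q i (s k) -
    n * ∑ a, mass (joint p₀ Q) a * statistic p₀ Q i a| ≤ n * ε

variable {p₀ Q}

/-- The indicator statistics `.inr (i, c)` control every cell of the joint type within `ε`; summing
over cells gives the cardinality factor. -/
theorem Typical.tv_le {ε : ℝ} {n : ℕ} (hn : 0 < n) {s : Fin n → 𝕏 × 𝕐 × 𝕐 × 𝕐}
    (h : Typical p₀ Q ε s) (i : Fin 3) :
    tv (jointType (fun k => (s k).1) fun k => recon i (s k).2)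
      (mass (joint p₀ (condMap Q (recon i)))) ≤ Fintype.card (𝕏 × 𝕐) * ε := by
  classical
  refine tv_jointType_le hn _ _ _ fun c => ?_
  have := h.2 (.inr (i, c))
  have e : ∑ a, mass (joint p₀ Q) a * statistic p₀ Q (.inr (i, c)) a =
      mass (joint p₀ (condMap Q (recon i))) c := by
    rw [← map_joint, mass_map]
    simp only [statistic, eq_comm, mul_ite, mul_one, mul_zero]
    exact Finset.sum_congr rfl fun a _ => by congr
  rw [e] at this
  simp only [statistic] at this
  convert this using 6

/-- Letterwise changes of measure multiply, and the sample mean of `h` bounds the total exponent.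
This supplies the domination constants of the covering bound. -/
theorem prod_le_exp_mul_prod {α : Type*} {n : ℕ} {s : Fin n → α} {f g h : α → ℝ}
    (hfg : ∀ k, f (s k) = Real.exp (h (s k)) * g (s k)) (hg : ∀ k, 0 ≤ g (s k)) {m ε : ℝ}
    (hh : |∑ k, h (s k) - n * m| ≤ n * ε) :
    ∏ k, f (s k) ≤ Real.exp (n * (m + ε)) * ∏ k, g (s k) := by
  rw [Finset.prod_congr rfl fun k _ => hfg k, Finset.prod_mul_distrib, ← Real.exp_sum]
  refine mul_le_mul_of_nonneg_right (Real.exp_le_exp.2 ?_) (Finset.prod_nonneg fun k _ => hg k)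
  linarith [(abs_le.1 hh).2]

theorem Typical.prod_fst_le {ε : ℝ} {n : ℕ} {s : Fin n → 𝕏 × 𝕐 × 𝕐 × 𝕐}
    (h : Typical p₀ Q ε s) : ∏ k, mass ((Q (s k).1).map fun y => y.1) (s k).2.1 ≤
      Real.exp (n * (mutualInfo (joint p₀ (condMap Q fun y => y.1)) + ε)) *
        ∏ k, mass ((p₀.bind Q).map fun y => y.1) (s k).2.1 := by
  refine prod_le_exp_mul_prod (f := fun s => mass ((Q s.1).map fun y => y.1) s.2.1)
    (g := fun s => mass ((p₀.bind Q).map fun y => y.1) s.2.1) (h := statistic p₀ Q (.inl 0))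
    (fun k => mass_condMap_eq_exp_mul p₀ Q (fun y => y.1) (h.1 k)) (fun k => mass_nonneg _ _) ?_
  rw [← sum_mass_mul_infoDensity]
  exact h.2 (.inl 0)

theorem Typical.prod_snd_le {ε : ℝ} {n : ℕ} {s : Fin n → 𝕏 × 𝕐 × 𝕐 × 𝕐}
    (h : Typical p₀ Q ε s) : ∏ k, mass ((Q (s k).1).map fun y => y.2.1) (s k).2.2.1 ≤
      Real.exp (n * (mutualInfo (joint p₀ (condMap Q fun y => y.2.1)) + ε)) *
        ∏ k, mass ((p₀.bind Q).map fun y => y.2.1) (s k).2.2.1 := by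
  refine prod_le_exp_mul_prod (f := fun s => mass ((Q s.1).map fun y => y.2.1) s.2.2.1)
    (g := fun s => mass ((p₀.bind Q).map fun y => y.2.1) s.2.2.1) (h := statistic p₀ Q (.inl 1))
    (fun k => mass_condMap_eq_exp_mul p₀ Q (fun y => y.2.1) (h.1 k)) (fun k => mass_nonneg _ _) ?_
  rw [← sum_mass_mul_infoDensity]
  exact h.2 (.inl 1)

theorem Typical.prod_le {ε : ℝ} {n : ℕ} {s : Fin n → 𝕏 × 𝕐 × 𝕐 × 𝕐}
    (h : Typical p₀ Q ε s) : ∏ k, mass (Q (s k).1) (s k).2 ≤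
      Real.exp (n * (mutualInfo (joint p₀ Q) +
        mutualInfo ((p₀.bind Q).map fun y => (y.1, y.2.1)) + ε)) *
        ∏ k, (mass ((p₀.bind Q).map fun y => y.1) (s k).2.1 *
          mass ((p₀.bind Q).map fun y => y.2.1) (s k).2.2.1 *
          thirdLaw (p₀.bind Q) (s k).2.1 (s k).2.2.1 (s k).2.2.2) := by
  refine prod_le_exp_mul_prod (f := fun s => mass (Q s.1) s.2)
    (g := fun s => mass ((p₀.bind Q).map fun y => y.1) s.2.1 *
          mass ((p₀.bind Q).map fun y => y.2.1) s.2.2.1 *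
          thirdLaw (p₀.bind Q) s.2.1 s.2.2.1 s.2.2.2) (h := statistic p₀ Q (.inl 2))
    (fun k => mass_eq_exp_totalDensity_mul p₀ Q (h.1 k))
    (fun k => mul_nonneg (mul_nonneg (mass_nonneg _ _) (mass_nonneg _ _))
      (thirdLaw_nonneg _ _ _ _)) ?_
  rw [← sum_mass_mul_totalDensity]
  exact h.2 (.inl 2)

variable (p₀ Q)

-- Drawing x from the source and then (u, v, z) through `Q` makes the letters i.i.d. with law `joint
-- p₀ Q`, so the law of large numbers applies.
open Classical in
theorem sum_not_typical_le {ε : ℝ} (hε : 0 < ε) {n : ℕ} (hn : 0 < n) :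
    ∑ x : Fin n → 𝕏, (∏ k, mass p₀ (x k)) * (∑ u : Fin n → 𝕐, ∑ v : Fin n → 𝕐, ∑ z : Fin n → 𝕐,
        (∏ k, mass (Q (x k)) (u k, v k, z k)) *
          if Typical p₀ Q ε fun k => (x k, u k, v k, z k) then 0 else 1) ≤
      (∑ i, ∑ a, mass (joint p₀ Q) a * (statistic p₀ Q i a -
        ∑ a, mass (joint p₀ Q) a * statistic p₀ Q i a) ^ 2) / ε ^ 2 / n := by
  refine le_trans (le_of_eq ?_) (sum_atypical_le (p := mass (joint p₀ Q)) (mass_nonneg _)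
    (sum_mass _) (statistic p₀ Q) hε hn)
  rw [sum_arrow_prod]
  refine Finset.sum_congr rfl fun x _ => ?_
  rw [sum_arrow_prod, Finset.mul_sum]
  refine Finset.sum_congr rfl fun u _ => ?_
  rw [sum_arrow_prod, Finset.mul_sum]
  refine Finset.sum_congr rfl fun v _ => ?_
  rw [Finset.mul_sum]
  refine Finset.sum_congr rfl fun z _ => ?_
  simp only [mass_joint, Finset.prod_mul_distrib, mul_assoc, Typical]

variable {n : ℕ} (x : Fin n → 𝕏)

omit [Fintype 𝕏] in
theorem sum_prod_mass_eq_one : ∑ u : Fin n → 𝕐, ∑ v : Fin n → 𝕐, ∑ z : Fin n → 𝕐,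
    ∏ k, mass (Q (x k)) (u k, v k, z k) = 1 := by
  have := sum_pi_prod_eq_one (q := fun k => mass (Q (x k))) fun _ => sum_mass _
  rw [sum_arrow_prod] at this
  rw [← this]
  refine Finset.sum_congr rfl fun u _ => ?_
  rw [sum_arrow_prod]

omit [Fintype 𝕏] in
theorem sum_prod_mass_fst (u : Fin n → 𝕐) : ∑ v : Fin n → 𝕐, ∑ z : Fin n → 𝕐,
    ∏ k, mass (Q (x k)) (u k, v k, z k) = ∏ k, mass ((Q (x k)).map fun y => y.1) (u k) := by
  simp only [mass_map_fst]
  rw [← sum_arrow_prod fun s : Fin n → 𝕐 × 𝕐 => ∏ k, mass (Q (x k)) (u k, s k),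
    sum_pi_prod fun k (b : 𝕐 × 𝕐) => mass (Q (x k)) (u k, b)]
  simp only [Fintype.sum_prod_type]

omit [Fintype 𝕏] in
theorem sum_prod_mass_snd (v : Fin n → 𝕐) : ∑ u : Fin n → 𝕐, ∑ z : Fin n → 𝕐,
    ∏ k, mass (Q (x k)) (u k, v k, z k) = ∏ k, mass ((Q (x k)).map fun y => y.2.1) (v k) := by
  simp only [mass_map_snd_fst]
  rw [← sum_arrow_prod fun s : Fin n → 𝕐 × 𝕐 => ∏ k, mass (Q (x k)) ((s k).1, v k, (s k).2),
    sum_pi_prod fun k (b : 𝕐 × 𝕐) => mass (Q (x k)) (b.1, v k, b.2)]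
  simp only [Fintype.sum_prod_type]

theorem prod_mass_nonneg {α : Type*} (p : Fin n → PMF α) (s : Fin n → α) :
    0 ≤ ∏ k, mass (p k) (s k) :=
  Finset.prod_nonneg fun _ _ => mass_nonneg _ _

theorem sum_prod_mass {α : Type*} [Fintype α] (p : PMF α) :
    ∑ s : Fin n → α, ∏ k, mass p (s k) = 1 :=
  sum_pi_prod_eq_one (q := fun _ => mass p) fun _ => sum_mass _

open Classical in
/-- Block covering: codebooks of any sizes for which the typical set is missed with a probability
governed by the rate conditions. -/
theorem exists_codebook_typical {ε : ℝ} (hε : 0 < ε) : ∃ K : ℝ, ∀ n : ℕ, 0 < n →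
    ∀ M₁ M₂ : ℕ, 0 < M₁ → 0 < M₂ →
    ∃ (U : Fin M₁ → Fin n → 𝕐) (V : Fin M₂ → Fin n → 𝕐) (Z : Fin M₁ × Fin M₂ → Fin n → 𝕐),
      ∑ x : Fin n → 𝕏, (∏ k, mass p₀ (x k)) *
        (if ∃ j : Fin M₁ × Fin M₂, Typical p₀ Q ε fun k => (x k, U j.1 k, V j.2 k, Z j k)
          then 0 else 1) ≤
      K / n +
        ((Real.exp (n * (mutualInfo (joint p₀ (condMap Q fun y => y.2.1)) + ε)) + 1) / M₂ +
        (Real.exp (n * (mutualInfo (joint p₀ (condMap Q fun y => y.1)) + ε)) + 1) / M₁ +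
        2 * (Real.exp (n * (mutualInfo (joint p₀ Q) +
          mutualInfo ((p₀.bind Q).map fun y => (y.1, y.2.1)) + ε)) + 1) / (M₁ * M₂)) := by
  refine ⟨(∑ i, ∑ a, mass (joint p₀ Q) a * (statistic p₀ Q i a -
    ∑ a, mass (joint p₀ Q) a * statistic p₀ Q i a) ^ 2) / ε ^ 2, fun n hn M₁ M₂ hM₁ hM₂ => ?_⟩
  have : Nonempty (Fin M₁) := ⟨⟨0, hM₁⟩⟩
  have : Nonempty (Fin M₂) := ⟨⟨0, hM₂⟩⟩
  have hd (x : Fin n → 𝕏) (u v z : Fin n → 𝕐)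
      (h : Typical p₀ Q ε fun k => (x k, u k, v k, z k)) := by
    have := h.prod_le
    simp only [Finset.prod_mul_distrib] at this
    exact this
  have hd₁ (x : Fin n → 𝕏) (u v z : Fin n → 𝕐)
      (h : Typical p₀ Q ε fun k => (x k, u k, v k, z k)) :=
    (sum_prod_mass_fst Q x u).trans_le h.prod_fst_le
  have hd₂ (x : Fin n → 𝕏) (u v z : Fin n → 𝕐)
      (h : Typical p₀ Q ε fun k => (x k, u k, v k, z k)) :=
    (sum_prod_mass_snd Q x v).trans_le h.prod_snd_le
  have hκ (u v z : Fin n → 𝕐) : 0 ≤ ∏ k, thirdLaw (p₀.bind Q) (u k) (v k) (z k) :=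
    Finset.prod_nonneg fun _ _ => thirdLaw_nonneg _ _ _ _
  have sκ (u v : Fin n → 𝕐) : ∑ z : Fin n → 𝕐, ∏ k, thirdLaw (p₀.bind Q) (u k) (v k) (z k) = 1 :=
    sum_pi_prod_eq_one (q := fun k => thirdLaw (p₀.bind Q) (u k) (v k)) fun _ => sum_thirdLaw _ _ _
  generalize (p₀.bind Q).map (fun y => y.1) = P₁ at hd hd₁
  generalize (p₀.bind Q).map (fun y => y.2.1) = P₂ at hd hd₂
  obtain ⟨U, V, Z, h⟩ := exists_codebook (I := Fin M₁) (J := Fin M₂) (A := Fin n → 𝕏)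
    (fun x => prod_mass_nonneg (fun _ => p₀) x) (sum_prod_mass p₀)
    (fun u => prod_mass_nonneg (fun _ => P₁) u) (sum_prod_mass P₁)
    (fun v => prod_mass_nonneg (fun _ => P₂) v) (sum_prod_mass P₂)
    hκ sκ (W := fun x u v z => ∏ k, mass (Q (x k)) (u k, v k, z k))
    (fun x u v z => prod_mass_nonneg (fun k => Q (x k)) fun k => (u k, v k, z k))
    (sum_prod_mass_eq_one Q) (fun x u v z => Typical p₀ Q ε fun k => (x k, u k, v k, z k))
    (Real.exp_nonneg _) (Real.exp_nonneg _) (Real.exp_nonneg _) hd hd₁ hd₂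
  refine ⟨U, V, Z, ?_⟩
  rw [Fintype.card_fin, Fintype.card_fin] at h
  exact h.trans (add_le_add_left (sum_not_typical_le p₀ Q hε hn) _)

end TestChannel

open Filter Topology

/-! ### From covering to coordination codes -/

section Achievability

variable {𝕏 𝕐 : Type*} [Fintype 𝕏] [Fintype 𝕐]

/-- Triangle inequality through `p'` on good sequences; on the others total variation is at most 1.
-/
theorem expectedTV_le {n : ℕ} (hn : 0 < n) (p₀ : PMF 𝕏) (p p' : PMF (𝕏 × 𝕐)) {Δ c : ℝ}
    (hΔ : tv (mass p) (mass p') ≤ Δ) (hc : 0 ≤ c) (g : (Fin n → 𝕏) → Fin n → 𝕐)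
    (good : (Fin n → 𝕏) → Prop) [DecidablePred good]
    (h : ∀ x, good x → tv (jointType x (g x)) (mass p') ≤ c) :
    expectedTV p₀ p g ≤ Δ + (c + ∑ x : Fin n → 𝕏, (∏ k, mass p₀ (x k)) *
      if good x then 0 else 1) := by
  have hΔ0 : 0 ≤ Δ := (tv_nonneg _ _).trans hΔ
  have s : ∑ x : Fin n → 𝕏, ∏ k, mass p₀ (x k) = 1 :=
    sum_pi_prod_eq_one (q := fun _ => mass p₀) fun _ => sum_mass _
  calc expectedTV p₀ p g ≤ ∑ x : Fin n → 𝕏, (∏ k, mass p₀ (x k)) *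
        ((Δ + c) + if good x then 0 else 1) := by
        refine Finset.sum_le_sum fun x _ => mul_le_mul_of_nonneg_left ?_
          (Finset.prod_nonneg fun _ _ => mass_nonneg _ _)
        split_ifs with hx
        · rw [tv_comm] at hΔ
          linarith [h x hx, tv_triangle (jointType x (g x)) (mass p') (mass p)]
        · linarith [tv_jointType_le_one hn x (g x) p]
    _ = _ := by
        simp only [mul_add, Finset.sum_add_distrib, ← Finset.sum_mul, s, one_mul, add_assoc]

/-- For `R ≥ 0` the floor is at least 1, so rounding down loses at most a factor 2. -/
theorem half_exp_le_numMessages {R : ℝ} (hR : 0 ≤ R) (n : ℕ) :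
    Real.exp (n * R) / 2 ≤ numMessages R n := by
  have h1 : 1 ≤ Real.exp (n * R) := Real.one_le_exp (by positivity)
  have h2 := Nat.lt_floor_add_one (Real.exp (n * R))
  have h3 : (1 : ℝ) ≤ ⌊Real.exp (n * R)⌋₊ := by
    exact_mod_cast Nat.one_le_floor_iff _ |>.2 h1
  unfold numMessages
  linarith

theorem exp_add_one_le {r s : ℝ} (hr : 0 ≤ r) (h : r ≤ s) : Real.exp r + 1 ≤ 2 * Real.exp s := by
  linarith [Real.one_le_exp hr, Real.exp_le_exp.2 h]

theorem achievable_add (p₀ : PMF 𝕏) (W : 𝕏 → PMF 𝕐) (Q : 𝕏 → PMF (𝕐 × 𝕐 × 𝕐))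
    {R₁ R₂ Δ₁ Δ₂ Δ₁₂ : ℝ}
    (hΔ₁ : joint p₀ (condMap Q fun y => y.1) ∈ neighborhood Δ₁ (joint p₀ W))
    (hΔ₂ : joint p₀ (condMap Q fun y => y.2.1) ∈ neighborhood Δ₂ (joint p₀ W))
    (hΔ₁₂ : joint p₀ (condMap Q fun y => y.2.2) ∈ neighborhood Δ₁₂ (joint p₀ W))
    (hR : (R₁, R₂) ∈ rateRegion p₀ Q) {δ : ℝ} (hδ : 0 < δ) :
    Achievable p₀ W (R₁ + δ) (R₂ + δ) (Δ₁ + δ) (Δ₂ + δ) (Δ₁₂ + δ) := by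
  classical
  obtain ⟨hR₁, hR₂, hR₁₂⟩ := hR
  dsimp only at hR₁ hR₂ hR₁₂
  set J₁ := mutualInfo (joint p₀ (condMap Q fun y => y.1))
  set J₂ := mutualInfo (joint p₀ (condMap Q fun y => y.2.1))
  set J := mutualInfo (joint p₀ Q) + mutualInfo ((p₀.bind Q).map fun y => (y.1, y.2.1))
  have hJ₁ : 0 ≤ J₁ := mutualInfo_nonneg _
  have hJ₂ : 0 ≤ J₂ := mutualInfo_nonneg _
  have hJ : 0 ≤ J := add_nonneg (mutualInfo_nonneg _) (mutualInfo_nonneg _)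
  set m : ℝ := (Fintype.card (𝕏 × 𝕐) : ℝ)
  have hm0 : 0 ≤ m := Nat.cast_nonneg _
  -- Chosen so that `m * ε` (distortion) and `ε` (exponent) together use δ/2; the other half of δ
  -- gives the decay of the error terms.
  set ε : ℝ := δ / (2 * (m + 1)) with hε
  have hε0 : 0 < ε := by positivity
  have hmε : m * ε + ε = δ / 2 := by
    rw [hε]
    field_simp
  have hmε0 : 0 ≤ m * ε := by positivity
  obtain ⟨K, hK⟩ := exists_codebook_typical p₀ Q hε0
  -- 24 = 4 + 4 + 16, the constants of `b₁`, `b₂` and `b` below.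
  have hlim : Tendsto (fun n : ℕ => K / (n : ℝ) + 24 * Real.exp (-(n * (δ / 2)))) atTop (𝓝 0) := by
    have h1 : Tendsto (fun n : ℕ => (n : ℝ) * (δ / 2)) atTop atTop :=
      tendsto_natCast_atTop_atTop.atTop_mul_const (half_pos hδ)
    have h2 := ((Real.tendsto_exp_neg_atTop_nhds_zero.comp h1).const_mul 24)
    simpa using (tendsto_const_div_atTop_nhds_zero_nat K).add h2
  obtain ⟨N, hN⟩ := eventually_atTop.1 (hlim.eventually_le_const (half_pos hδ))
  refine ⟨N, fun n hn => ?_⟩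
  have hn0 : 0 < n := (Nat.zero_le N).trans_lt hn
  have hnR : (0 : ℝ) < n := Nat.cast_pos.2 hn0
  have hM₁ := half_exp_le_numMessages (R := R₁ + δ) (by linarith) n
  have hM₂ := half_exp_le_numMessages (R := R₂ + δ) (by linarith) n
  set M₁ := numMessages (R₁ + δ) n
  set M₂ := numMessages (R₂ + δ) n
  have hM₁0 : (0 : ℝ) < M₁ := (by positivity : 0 < Real.exp (n * (R₁ + δ)) / 2).trans_le hM₁
  have hM₂0 : (0 : ℝ) < M₂ := (by positivity : 0 < Real.exp (n * (R₂ + δ)) / 2).trans_le hM₂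
  have b₁ : (Real.exp (n * (J₁ + ε)) + 1) / M₁ ≤ 4 * Real.exp (-(n * (δ / 2))) := by
    rw [div_le_iff₀ hM₁0]
    have h1 : Real.exp (n * (J₁ + ε)) + 1 ≤ 2 * Real.exp (-(n * (δ / 2)) + n * (R₁ + δ)) :=
      exp_add_one_le (by positivity) (by nlinarith)
    rw [Real.exp_add] at h1
    nlinarith [Real.exp_pos (-(n * (δ / 2)))]
  have b₂ : (Real.exp (n * (J₂ + ε)) + 1) / M₂ ≤ 4 * Real.exp (-(n * (δ / 2))) := by
    rw [div_le_iff₀ hM₂0]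
    have h1 : Real.exp (n * (J₂ + ε)) + 1 ≤ 2 * Real.exp (-(n * (δ / 2)) + n * (R₂ + δ)) :=
      exp_add_one_le (by positivity) (by nlinarith)
    rw [Real.exp_add] at h1
    nlinarith [Real.exp_pos (-(n * (δ / 2)))]
  -- Prefactor 2, a 2 from absorbing the `+ 1`, and a 2 from each floor give 16.
  have b : 2 * (Real.exp (n * (J + ε)) + 1) / (M₁ * M₂) ≤ 16 * Real.exp (-(n * (δ / 2))) := by
    rw [div_le_iff₀ (by positivity)]
    have h1 : Real.exp (n * (J + ε)) + 1 ≤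
        2 * Real.exp (-(n * (δ / 2)) + (n * (R₁ + δ) + n * (R₂ + δ))) :=
      exp_add_one_le (by positivity) (by nlinarith)
    rw [Real.exp_add, Real.exp_add] at h1
    have h2 := mul_le_mul hM₁ hM₂ (by positivity) hM₁0.le
    nlinarith [Real.exp_pos (-(n * (δ / 2)))]
  obtain ⟨U, V, Z, hmiss⟩ := hK n hn0 M₁ M₂ (Nat.cast_pos.1 hM₁0) (Nat.cast_pos.1 hM₂0)
  set good : (Fin n → 𝕏) → Prop := fun x => ∃ j : Fin M₁ × Fin M₂,
    Typical p₀ Q ε fun k => (x k, U j.1 k, V j.2 k, Z j k)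
  have hsmall := hN n hn.le
  have hfail : m * ε + ∑ x : Fin n → 𝕏, (∏ k, mass p₀ (x k)) *
      (if good x then 0 else 1) ≤ δ := by
    linarith
  have : Nonempty (Fin M₁ × Fin M₂) :=
    ⟨⟨0, Nat.cast_pos.1 hM₁0⟩, ⟨0, Nat.cast_pos.1 hM₂0⟩⟩
  -- One choice of index pair serves both encoders; on bad words it is arbitrary.
  choose! e he using fun (x : Fin n → 𝕏) (hx : good x) => hx
  refine ⟨⟨fun x => (e x).1, fun x => (e x).2, U, V, Z⟩, ?_, ?_, ?_⟩
  · exact (expectedTV_le hn0 p₀ _ _ hΔ₁ hmε0 _ good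
      fun x hx => (he x hx).tv_le hn0 0).trans (add_le_add_right hfail _)
  · exact (expectedTV_le hn0 p₀ _ _ hΔ₂ hmε0 _ good
      fun x hx => (he x hx).tv_le hn0 1).trans (add_le_add_right hfail _)
  · exact (expectedTV_le hn0 p₀ _ _ hΔ₁₂ hmε0 _ good
      fun x hx => (he x hx).tv_le hn0 2).trans (add_le_add_right hfail _)

end Achievability

end Coordination

theorem theorem1 {𝕏 𝕐 : Type*} [Fintype 𝕏] [Fintype 𝕐] (p₀ : PMF 𝕏) (W : 𝕏 → PMF 𝕐) :
    {t : ℝ × ℝ × ℝ × ℝ × ℝ | ∃ R₁ R₂ Δ₁ Δ₂ Δ₁₂ : ℝ, t = (R₁, R₂, Δ₁, Δ₂, Δ₁₂) ∧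
      ∃ Q : 𝕏 → PMF (𝕐 × 𝕐 × 𝕐),
        Coordination.joint p₀ (Coordination.condMap Q fun y => y.1) ∈
          Coordination.neighborhood Δ₁ (Coordination.joint p₀ W) ∧
        Coordination.joint p₀ (Coordination.condMap Q fun y => y.2.1) ∈
          Coordination.neighborhood Δ₂ (Coordination.joint p₀ W) ∧
        Coordination.joint p₀ (Coordination.condMap Q fun y => y.2.2) ∈
          Coordination.neighborhood Δ₁₂ (Coordination.joint p₀ W) ∧
        (R₁, R₂) ∈ Coordination.rateRegion p₀ Q} ⊆
    Coordination.region p₀ W := by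
  rintro _ ⟨R₁, R₂, Δ₁, Δ₂, Δ₁₂, rfl, Q, h₁, h₂, h₁₂, hR⟩
  -- The tuples shifted by δ > 0 are achievable and converge to the given one as δ → 0.
  have hlim : Filter.Tendsto (fun δ : ℝ => (R₁ + δ, R₂ + δ, Δ₁ + δ, Δ₂ + δ, Δ₁₂ + δ))
      (nhdsWithin 0 (Set.Ioi 0)) (nhds (R₁, R₂, Δ₁, Δ₂, Δ₁₂)) := by
    refine Filter.Tendsto.mono_left ?_ nhdsWithin_le_nhds
    have hc : Continuous fun δ : ℝ => (R₁ + δ, R₂ + δ, Δ₁ + δ, Δ₂ + δ, Δ₁₂ + δ) := by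
      fun_prop
    simpa using hc.tendsto 0
  exact mem_closure_of_tendsto hlim <| Filter.eventually_of_mem self_mem_nhdsWithin
    fun δ hδ => Coordination.achievable_add p₀ W Q h₁ h₂ h₁₂ hR hδ
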